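/- Let $n\ge 1$ and $m\ge 0$ be integers and let $f:\mathbb{R}^n\to\mathbb{R}$ be a function (no regularity is assumed) that satisfies Fréchet's functional equation $$\Delta_h^{m+1}f(x)=0\qquad\text{for all } x,h\in\mathbb{R}^n,$$ where $\Delta_h^1 f(x)=f(x+h)-f(x)$ and $\Delta_h^{k+1}f=\Delta_h^1(\Delta_h^k f)$ for $k\ge 1$. Suppose that $f$ is not an ordinary polynomial, that is, there is no polynomial $p\in\mathbb{R}[x_1,\dots,x_n]$ with $f(x)=p(x)$ for all $x\in\mathbb{R}^n$. Then $f$ is locally unbounded: for every non-empty open set $U\subseteq\mathbb{R}^n$, the set $f(U)$ is unbounded in $\mathbb{R}$. Furthermore, the closure in $\mathbb{R}^{n+1}$ of the graph $G(f)=\{(x,f(x)):x\in\mathbb{R}^n\}$ contains an unbounded open subset of $\mathbb{R}^{n+1}$. -/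

import Mathlib

/-- Fréchet's functional equation of order `m + 1` on `ℝⁿ`:
`Δ_h^{m+1} f(x) = 0` for all `x, h`, where `Δ_h g(x) = g(x + h) - g(x)` is Mathlib's forward
difference `fwdDiff h` and `Δ_h^{m+1}` is its `(m + 1)`-fold iterate. -/
def SatisfiesFrechet {n : ℕ} (m : ℕ) (f : (Fin n → ℝ) → ℝ) : Prop :=
  ∀ x h : Fin n → ℝ, ((fwdDiff h)^[m + 1] f) x = 0

/-- `f` is an ordinary algebraic polynomial in the variables `x₁, …, xₙ`. -/
def IsOrdinaryPolynomial {n : ℕ} (f : (Fin n → ℝ) → ℝ) : Prop :=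
  ∃ p : MvPolynomial (Fin n) ℝ, ∀ x : Fin n → ℝ, f x = MvPolynomial.eval x p

/-- The graph `G(f) = {(x₁, …, xₙ, f(x₁, …, xₙ))}` of `f`, as a subset of `ℝ^{n+1}`.
Only the topology and the bounded sets of `ℝⁿ` and `ℝ^{n+1}` are used, and these are the usual ones
on `Fin n → ℝ` and `Fin (n + 1) → ℝ`. -/
def functionGraph {n : ℕ} (f : (Fin n → ℝ) → ℝ) : Set (Fin (n + 1) → ℝ) :=
  Set.range fun x : Fin n → ℝ => (Fin.snoc x (f x) : Fin (n + 1) → ℝ)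

/-! On `ℚⁿ` a solution of Fréchet's equation agrees with a real polynomial `p`. If `f` is not a
polynomial, some `c` has `f c ≠ p(c)`. On `ℚⁿ + ℚc`, `f` is again a polynomial `P(t, x)` at `x +
tc`, so by density every point `(x + tc, P(t, x))` with real `t`, `x` lies in the closure of the
graph. Over a fixed `y` the closure thus contains all values `F(t, y) = P(t, y - tc)`, and `F`
really involves `t`, since `F(0, c) = p(c)` and `F(1, c) = f c`. Wherever the leading coefficient of
`F` in `t` is nonzero, which happens in every non-empty open set, these values fill a half-line. -/

/-! ### Polynomiality on rational points -/

lemma fwdDiff_iter_comp_affine {M M' G : Type*} [AddCommGroup M] [AddCommGroup M'] [AddCommGroup G]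
    (f : M → G) (φ : M' →+ M) (a : M) (h x : M') (k : ℕ) :
    (fwdDiff h)^[k] (fun y => f (a + φ y)) x = (fwdDiff (φ h))^[k] f (a + φ x) := by
  simp [fwdDiff_iter_eq_sum_shift, add_assoc]

/-- A function whose `(m + 1)`-st differences with step `h` vanish is a polynomial of degree at
most `m` along each progression with step `h`. -/
lemma exists_polynomial_eval_nat {M : Type*} [AddCommGroup M] (g : M → ℝ) (m : ℕ) (h : M)
    (hg : ∀ x, (fwdDiff h)^[m + 1] g x = 0) (x : M) :
    ∃ r : Polynomial ℝ, r.natDegree ≤ m ∧ ∀ k : ℕ, g (x + k • h) = r.eval (k : ℝ) := by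
  have hzero : ∀ i, m < i → (fwdDiff h)^[i] g x = 0 := by
    intro i hi
    obtain ⟨j, rfl⟩ := Nat.exists_eq_add_of_lt hi
    have h0 : (fwdDiff h)^[m + 1] g = 0 := funext hg
    rw [show m + j + 1 = j + (m + 1) by ring, Function.iterate_add_apply, h0]
    simp [fwdDiff_iter_eq_sum_shift]
  -- Newton's forward difference formula, cut off at degree `m`.
  refine ⟨∑ i ∈ Finset.range (m + 1), Polynomial.C ((fwdDiff h)^[i] g x / (i.factorial : ℝ)) *
    descPochhammer ℝ i, ?_, fun k => ?_⟩
  · refine Polynomial.natDegree_sum_le_of_forall_le _ _ fun i hi => ?_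
    refine (Polynomial.natDegree_C_mul_le _ _).trans ?_
    rw [descPochhammer_natDegree]
    exact Nat.lt_succ_iff.mp (Finset.mem_range.mp hi)
  · have hterm : ∀ i, k.choose i • (fwdDiff h)^[i] g x =
        (fwdDiff h)^[i] g x / (i.factorial : ℝ) * (k.descFactorial i : ℝ) := by
      intro i
      rw [Nat.descFactorial_eq_factorial_mul_choose, nsmul_eq_mul]
      push_cast
      have : (i.factorial : ℝ) ≠ 0 := by exact_mod_cast i.factorial_ne_zero
      field_simp
    rw [shift_eq_sum_fwdDiff_iter h g, Polynomial.eval_finsetSum]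
    simp only [Polynomial.eval_mul, Polynomial.eval_C, descPochhammer_eval_eq_descFactorial,
      ← hterm]
    rcases le_total k m with hkm | hkm
    · refine Finset.sum_subset (Finset.range_mono (by omega)) fun i _ hi => ?_
      rw [Nat.choose_eq_zero_of_lt (by simpa using hi), zero_smul]
    · refine (Finset.sum_subset (Finset.range_mono (by omega)) fun i _ hi => ?_).symm
      rw [hzero i (by simpa using hi), smul_zero]

/-- The progression of step `1 / q.den` from `-|q.num|` passes through both `q` and `0, …, m`. Along
it `g` has degree at most `m`, so its values at these `m + 1` integers determine it. -/
lemma eq_eval_interpolate_of_fwdDiff_iter_eq_zero (g : ℚ → ℝ) (m : ℕ)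
    (hg : ∀ x h, (fwdDiff h)^[m + 1] g x = 0) (q : ℚ) :
    g q = (Lagrange.interpolate (Finset.range (m + 1)) (fun i : ℕ => (i : ℝ))
      fun i => g i).eval (q : ℝ) := by
  set p := Lagrange.interpolate (Finset.range (m + 1)) (fun i : ℕ => (i : ℝ)) fun i => g i
  have hinj : Set.InjOn (fun i : ℕ => (i : ℝ)) (Finset.range (m + 1)) :=
    Nat.cast_injective.injOn
  have hpdeg : p.natDegree ≤ m := by
    refine Polynomial.natDegree_le_iff_degree_le.mpr (Order.lt_succ_iff.mp ?_)
    have h := Lagrange.degree_interpolate_lt (fun i : ℕ => g i) hinj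
    rw [Finset.card_range] at h
    exact h
  have hN0 : (q.den : ℚ) ≠ 0 := by exact_mod_cast q.den_ne_zero
  have hN0' : (q.den : ℝ) ≠ 0 := by exact_mod_cast q.den_ne_zero
  set a := q.num.natAbs
  obtain ⟨r, hrdeg, hr⟩ := exists_polynomial_eval_nat g m (1 / q.den : ℚ) (fun x => hg x _) (-a)
  have hrs : r = p.comp
      (Polynomial.C (1 / (q.den : ℝ)) * Polynomial.X + Polynomial.C (-a : ℝ)) := by
    have hcard : ((Finset.range (m + 1)).card : WithBot ℕ) = ((m + 1 : ℕ) : WithBot ℕ) := by simp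
    -- The progression reaches the integer `i` at index `q.den * (a + i)`.
    refine Polynomial.eq_of_degrees_lt_of_eval_index_eq (Finset.range (m + 1))
      (v := fun i : ℕ => ((q.den * (a + i) : ℕ) : ℝ)) ?_ ?_ ?_ ?_
    · intro i _ j _ hij
      have h1 : q.den * (a + i) = q.den * (a + j) := Nat.cast_injective hij
      have := Nat.eq_of_mul_eq_mul_left q.den_pos h1
      omega
    · rw [hcard]
      exact Polynomial.degree_le_natDegree.trans_lt (by exact_mod_cast Nat.lt_succ_of_le hrdeg)
    · rw [hcard]
      refine Polynomial.degree_le_natDegree.trans_lt (Nat.cast_lt.mpr (Nat.lt_succ_of_le ?_))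
      refine Polynomial.natDegree_comp_le.trans ?_
      calc _ ≤ m * 1 := Nat.mul_le_mul hpdeg Polynomial.natDegree_linear_le
        _ = m := mul_one m
    · intro i hi
      rw [← hr]
      have h1 : (-a + (q.den * (a + i)) • (1 / q.den : ℚ) : ℚ) = i := by
        rw [nsmul_eq_mul]; push_cast; field_simp; ring
      have h2 : (1 / (q.den : ℝ)) * ((q.den * (a + i) : ℕ) : ℝ) + (-a : ℝ) = i := by
        push_cast; field_simp; ring
      rw [h1]
      simp only [Polynomial.eval_comp, Polynomial.eval_add, Polynomial.eval_mul, Polynomial.eval_C,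
        Polynomial.eval_X]
      rw [h2]
      exact (Lagrange.eval_interpolate_at_node (fun i : ℕ => g i) hinj hi).symm
  obtain ⟨k, hk⟩ : ∃ k : ℕ, (k : ℤ) = q.num + a * q.den := by
    refine ⟨(q.num + a * q.den).toNat, Int.toNat_of_nonneg ?_⟩
    have h1 : -(a : ℤ) ≤ q.num := by omega
    have h2 : (1 : ℤ) ≤ q.den := by exact_mod_cast q.den_pos
    nlinarith
  have hkq : (k : ℚ) = q.num + a * q.den := by exact_mod_cast hk
  have hq : (-a + k • (1 / q.den : ℚ) : ℚ) = q := by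
    rw [nsmul_eq_mul, hkq]
    nth_rewrite 4 [← Rat.num_div_den q]
    field_simp; ring
  have hqr : (1 / (q.den : ℝ)) * k + (-a : ℝ) = q := by
    have h := congrArg (Rat.cast : ℚ → ℝ) hq
    rw [← h]
    simp only [nsmul_eq_mul]
    push_cast
    ring
  have := hr k
  rw [hq, hrs] at this
  simp only [Polynomial.eval_comp, Polynomial.eval_add, Polynomial.eval_mul, Polynomial.eval_C,
    Polynomial.eval_X] at this
  rwa [hqr] at this

/-- Induction on `n`: Lagrange interpolation in the first variable recovers `g` from the slices at
`0, …, m`, which are polynomials in the remaining variables. -/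
lemma exists_mvPolynomial_of_fwdDiff_iter_eq_zero {n : ℕ} (m : ℕ) (g : (Fin n → ℚ) → ℝ)
    (hg : ∀ x h, (fwdDiff h)^[m + 1] g x = 0) :
    ∃ p : MvPolynomial (Fin n) ℝ, ∀ q : Fin n → ℚ,
      g q = MvPolynomial.eval (fun i => (q i : ℝ)) p := by
  induction n with
  | zero => exact ⟨MvPolynomial.C (g 0), fun q => by simp [Subsingleton.elim q 0]⟩
  | succ n ih =>
    have hslice : ∀ i : ℕ, ∃ p : MvPolynomial (Fin n) ℝ, ∀ q : Fin n → ℚ,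
        g (Fin.cons (i : ℚ) q) = MvPolynomial.eval (fun i => (q i : ℝ)) p := by
      intro i
      refine ih _ fun x h => ?_
      let φ : (Fin n → ℚ) →+ (Fin (n + 1) → ℚ) :=
        { toFun := fun q => Fin.cons 0 q
          map_zero' := by ext j; refine Fin.cases ?_ (fun j => ?_) j <;> simp
          map_add' := fun x y => by ext j; refine Fin.cases ?_ (fun j => ?_) j <;> simp }
      have heq : ∀ q : Fin n → ℚ, (Fin.cons (i : ℚ) q : Fin (n + 1) → ℚ) =
          Fin.cons (i : ℚ) 0 + φ q := by
        intro q; ext j; refine Fin.cases ?_ (fun j => ?_) j <;> simp [φ]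
      rw [show (fun q => g (Fin.cons (i : ℚ) q)) = fun q => g (Fin.cons (i : ℚ) 0 + φ q) from
        funext fun q => congrArg g (heq q)]
      rw [fwdDiff_iter_comp_affine, hg]
    choose P hP using hslice
    let b : ℕ → Polynomial ℝ := Lagrange.basis (Finset.range (m + 1)) (fun i : ℕ => (i : ℝ))
    refine ⟨∑ i ∈ Finset.range (m + 1), MvPolynomial.rename Fin.succ (P i) *
      Polynomial.aeval (MvPolynomial.X 0) (b i), fun q => ?_⟩
    have hline := eq_eval_interpolate_of_fwdDiff_iter_eq_zero
      (fun t => g (Fin.cons t (Fin.tail q))) m ?_ (q 0)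
    · simp only [Fin.cons_self_tail] at hline
      rw [hline, Lagrange.interpolate_apply, Polynomial.eval_finsetSum, map_sum]
      refine Finset.sum_congr rfl fun i _ => ?_
      rw [Polynomial.eval_mul, Polynomial.eval_C, map_mul, MvPolynomial.eval_rename, hP]
      congr 1
      have := Polynomial.aeval_algHom_apply
        (MvPolynomial.aeval (R := ℝ) fun i => (q i : ℝ)) (MvPolynomial.X 0) (b i)
      simp only [MvPolynomial.aeval_X] at this
      rw [Polynomial.coe_aeval_eq_eval] at this
      exact this
    · intro x h
      let φ : ℚ →+ (Fin (n + 1) → ℚ) :=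
        { toFun := fun t => Fin.cons t 0
          map_zero' := by ext j; refine Fin.cases ?_ (fun j => ?_) j <;> simp
          map_add' := fun x y => by ext j; refine Fin.cases ?_ (fun j => ?_) j <;> simp }
      have heq : ∀ t : ℚ, (Fin.cons t (Fin.tail q) : Fin (n + 1) → ℚ) =
          Fin.cons 0 (Fin.tail q) + φ t := by
        intro q; ext j; refine Fin.cases ?_ (fun j => ?_) j <;> simp [φ]
      rw [show (fun t => g (Fin.cons t (Fin.tail q))) =
          fun t => g (Fin.cons 0 (Fin.tail q) + φ t) from
        funext fun t => congrArg g (heq t)]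
      rw [fwdDiff_iter_comp_affine, hg]

/-! ### Polynomial families in the closure of the graph -/

lemma denseRange_ratCast_pi (n : ℕ) : DenseRange fun (q : Fin n → ℚ) i => (q i : ℝ) :=
  DenseRange.piMap fun _ => Rat.denseRange_cast

/-- If `f` solves Fréchet's equation and is not a polynomial, the closure of its graph contains the
graph `y ↦ F (t, y)` for every `t`, for some polynomial `F` that depends on the parameter `t`. -/
lemma exists_mvPolynomial_mem_closure_functionGraph {n m : ℕ} {f : (Fin n → ℝ) → ℝ}
    (hf : SatisfiesFrechet m f) (hpoly : ¬ IsOrdinaryPolynomial f) :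
    ∃ F : MvPolynomial (Fin (n + 1)) ℝ,
      (∀ (t : ℝ) (y : Fin n → ℝ), (Fin.snoc y (MvPolynomial.eval (Fin.cons t y) F) :
        Fin (n + 1) → ℝ) ∈ closure (functionGraph f)) ∧
      ∃ y : Fin n → ℝ, MvPolynomial.eval (Fin.cons 1 y) F ≠ MvPolynomial.eval (Fin.cons 0 y) F := by
  let ψ : (Fin n → ℚ) →+ (Fin n → ℝ) :=
    { toFun := fun q i => (q i : ℝ)
      map_zero' := by ext; simp
      map_add' := fun x y => by ext; simp }
  obtain ⟨p, hp⟩ := exists_mvPolynomial_of_fwdDiff_iter_eq_zero m (fun q => f (0 + ψ q))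
    fun x h => by rw [fwdDiff_iter_comp_affine]; exact hf _ _
  obtain ⟨c, hc⟩ : ∃ c, f c ≠ MvPolynomial.eval c p := by
    by_contra! h
    exact hpoly ⟨p, h⟩
  let φ : (Fin (n + 1) → ℚ) →+ (Fin n → ℝ) :=
    { toFun := fun q i => (q i.succ : ℝ) + q 0 * c i
      map_zero' := by ext; simp
      map_add' := fun x y => by ext; simp; ring }
  obtain ⟨P, hP⟩ := exists_mvPolynomial_of_fwdDiff_iter_eq_zero m (fun q => f (0 + φ q))
    fun x h => by rw [fwdDiff_iter_comp_affine]; exact hf _ _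
  simp only [zero_add] at hp hP
  have hPp : ∀ y : Fin n → ℝ, MvPolynomial.eval (Fin.cons 0 y) P = MvPolynomial.eval y p := by
    intro y
    refine congrFun ((denseRange_ratCast_pi n).equalizer
      (g := fun y => MvPolynomial.eval (Fin.cons 0 y) P) (h := fun y => MvPolynomial.eval y p)
      ((MvPolynomial.continuous_eval P).comp (continuous_const.finCons continuous_id))
      (MvPolynomial.continuous_eval p) ?_) y
    funext q
    have h1 := hP (Fin.cons 0 q)
    have h2 : φ (Fin.cons 0 q) = ψ q := by ext i; simp [φ, ψ]
    have h3 : (fun i => ((Fin.cons 0 q : Fin (n + 1) → ℚ) i : ℝ)) =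
        Fin.cons 0 (fun i => (q i : ℝ)) := by
      ext j; refine Fin.cases ?_ (fun j => ?_) j <;> simp
    rw [h2, h3, hp] at h1
    exact h1.symm
  have hPc : MvPolynomial.eval (Fin.cons 1 0) P = f c := by
    have h1 := hP (Fin.cons 1 0)
    have h2 : φ (Fin.cons 1 0) = c := by ext i; simp [φ]
    have h3 : (fun i => ((Fin.cons 1 0 : Fin (n + 1) → ℚ) i : ℝ)) = Fin.cons 1 0 := by
      ext j; refine Fin.cases ?_ (fun j => ?_) j <;> simp
    rw [h2, h3] at h1
    exact h1.symm
  have hclos : ∀ r : Fin (n + 1) → ℝ,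
      (Fin.snoc (fun i : Fin n => r i.succ + r 0 * c i) (MvPolynomial.eval r P) :
        Fin (n + 1) → ℝ) ∈ closure (functionGraph f) := by
    intro r
    have hcont : Continuous fun r : Fin (n + 1) → ℝ =>
        (Fin.snoc (fun i : Fin n => r i.succ + r 0 * c i) (MvPolynomial.eval r P) :
          Fin (n + 1) → ℝ) :=
      Continuous.finSnoc (by fun_prop) (MvPolynomial.continuous_eval P)
    refine map_mem_closure (f := fun r : Fin (n + 1) → ℝ => (Fin.snoc
      (fun i : Fin n => r i.succ + r 0 * c i) (MvPolynomial.eval r P) : Fin (n + 1) → ℝ))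
      hcont (denseRange_ratCast_pi (n + 1) r) ?_
    rintro _ ⟨q, rfl⟩
    exact ⟨φ q, by dsimp only; rw [hP]; rfl⟩
  -- Substituting `x = y - tc` makes `y` the base point for every `t`.
  let F : MvPolynomial (Fin (n + 1)) ℝ := MvPolynomial.bind₁
    (Fin.cons (MvPolynomial.X 0) fun i : Fin n =>
      MvPolynomial.X i.succ - MvPolynomial.X 0 * MvPolynomial.C (c i)) P
  have hF : ∀ (t : ℝ) (y : Fin n → ℝ), MvPolynomial.eval (Fin.cons t y) F =
      MvPolynomial.eval (Fin.cons t fun i => y i - t * c i) P := by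
    intro t y
    simp only [F, MvPolynomial.eval, MvPolynomial.eval₂Hom_bind₁]
    congr 2
    ext j
    refine Fin.cases ?_ (fun j => ?_) j <;> simp
  refine ⟨F, fun t y => ?_, c, ?_⟩
  · rw [hF]
    simpa using hclos (Fin.cons t fun i => y i - t * c i)
  · rw [hF, hF]
    simp only [one_mul, sub_self, zero_mul, sub_zero]
    rw [hPp]
    exact fun h => hc (hPc.symm.trans h)

/-! ### Half-lines of polynomial values -/

lemma MvPolynomial.exists_mem_eval_ne_zero {n : ℕ} {p : MvPolynomial (Fin n) ℝ} (hp : p ≠ 0)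
    {U : Set (Fin n → ℝ)} (hU : IsOpen U) (hne : U.Nonempty) :
    ∃ y ∈ U, MvPolynomial.eval y p ≠ 0 := by
  by_contra! h
  obtain ⟨x, hx⟩ := hne
  obtain ⟨ε, hε, hball⟩ := Metric.isOpen_iff.mp hU x hx
  refine hp (MvPolynomial.funext_set (fun i => Metric.ball (x i) ε) (fun i => ?_) fun y hy => ?_)
  · rw [Real.ball_eq_Ioo]
    exact Set.Ioo_infinite (by linarith)
  · rw [map_zero]
    exact h y (hball (by rwa [ball_pi x hε]))

lemma Polynomial.exists_eval_eq_of_leadingCoeff_pos {p : Polynomial ℝ} (hdeg : 0 < p.degree)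
    (hlc : 0 < p.leadingCoeff) {v : ℝ} (hv : p.eval 0 ≤ v) : ∃ t, p.eval t = v := by
  obtain ⟨s, hs⟩ :=
    ((p.tendsto_atTop_of_leadingCoeff_nonneg hdeg hlc.le).eventually_ge_atTop v).exists
  obtain ⟨t, -, ht⟩ := intermediate_value_uIcc (a := 0) (b := s) p.continuous.continuousOn
    (Set.mem_uIcc.mpr (Or.inl ⟨hv, hs⟩))
  exact ⟨t, ht⟩

lemma Polynomial.exists_eval_eq_of_leadingCoeff_neg {p : Polynomial ℝ} (hdeg : 0 < p.degree)
    (hlc : p.leadingCoeff < 0) {v : ℝ} (hv : v ≤ p.eval 0) : ∃ t, p.eval t = v := by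
  obtain ⟨t, ht⟩ := Polynomial.exists_eval_eq_of_leadingCoeff_pos (p := -p) (v := -v)
    (by rwa [Polynomial.degree_neg]) (by rw [Polynomial.leadingCoeff_neg]; linarith)
    (by rw [Polynomial.eval_neg]; linarith)
  exact ⟨t, by rw [Polynomial.eval_neg] at ht; linarith⟩

/-- A polynomial that depends on an additional variable `t` takes, over each point `y`, a half-line
of values, on the side given by the sign at `y` of its leading coefficient in `t`. -/
lemma MvPolynomial.exists_leadingCoeff_of_eval_cons_ne {n : ℕ} {F : MvPolynomial (Fin (n + 1)) ℝ}
    {y₀ : Fin n → ℝ}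
    (h : MvPolynomial.eval (Fin.cons 1 y₀) F ≠ MvPolynomial.eval (Fin.cons 0 y₀) F) :
    ∃ a : MvPolynomial (Fin n) ℝ, a ≠ 0 ∧ ∀ y : Fin n → ℝ,
      (0 < MvPolynomial.eval y a → ∀ v, MvPolynomial.eval (Fin.cons 0 y) F ≤ v →
        ∃ t : ℝ, MvPolynomial.eval (Fin.cons t y) F = v) ∧
      (MvPolynomial.eval y a < 0 → ∀ v, v ≤ MvPolynomial.eval (Fin.cons 0 y) F →
        ∃ t : ℝ, MvPolynomial.eval (Fin.cons t y) F = v) := by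
  simp only [MvPolynomial.eval_eq_eval_mv_eval'] at h ⊢
  -- `G` is `F` as a polynomial in `t` over the ring of polynomials in `y`; specializing `y` keeps
  -- its degree where the leading coefficient survives.
  set G := MvPolynomial.finSuccEquiv ℝ n F
  have hG : 0 < G.degree := by
    by_contra! hle
    rw [Polynomial.eq_C_of_degree_le_zero hle] at h
    simp at h
  have key : ∀ y : Fin n → ℝ, MvPolynomial.eval y G.leadingCoeff ≠ 0 →
      0 < (G.map (MvPolynomial.eval y)).degree ∧
      (G.map (MvPolynomial.eval y)).leadingCoeff = MvPolynomial.eval y G.leadingCoeff :=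
    fun y hy => ⟨by rwa [Polynomial.degree_map_eq_of_leadingCoeff_ne_zero _ hy],
      Polynomial.leadingCoeff_map_of_leadingCoeff_ne_zero _ hy⟩
  refine ⟨G.leadingCoeff, ?_, fun y => ⟨fun hy v hv => ?_, fun hy v hv => ?_⟩⟩
  · exact Polynomial.leadingCoeff_ne_zero.mpr (Polynomial.ne_zero_of_degree_gt hG)
  · obtain ⟨hd, hl⟩ := key y hy.ne'
    exact Polynomial.exists_eval_eq_of_leadingCoeff_pos hd (hl ▸ hy) hv
  · obtain ⟨hd, hl⟩ := key y hy.ne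
    exact Polynomial.exists_eval_eq_of_leadingCoeff_neg hd (hl ▸ hy) hv

/-! ### Unboundedness -/

lemma not_isBounded_of_forall_snoc_mem {n : ℕ} {W : Set (Fin (n + 1) → ℝ)} (y : Fin n → ℝ)
    {I : Set ℝ} (hI : ¬ Bornology.IsBounded I)
    (hW : ∀ v ∈ I, (Fin.snoc y v : Fin (n + 1) → ℝ) ∈ W) : ¬ Bornology.IsBounded W := by
  intro hb
  refine hI ((((LipschitzWith.eval (α := fun _ : Fin (n + 1) => ℝ) (Fin.last n)).isBounded_image
    hb)).subset fun v hv => ⟨_, hW v hv, ?_⟩)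
  simp

lemma Real.not_isBounded_Ioi (a : ℝ) : ¬ Bornology.IsBounded (Set.Ioi a) :=
  fun h => not_bddAbove_Ioi a h.bddAbove

lemma Real.not_isBounded_Iio (a : ℝ) : ¬ Bornology.IsBounded (Set.Iio a) :=
  fun h => not_bddBelow_Iio a h.bddBelow

/-- If the closure of the graph of `f` contains an unbounded part of the vertical line over a point
of the open set `U`, then `f` is unbounded on `U`. -/
lemma not_isBounded_image_of_snoc_mem_closure {n : ℕ} {f : (Fin n → ℝ) → ℝ} {U : Set (Fin n → ℝ)}
    (hU : IsOpen U) {y : Fin n → ℝ} (hy : y ∈ U) {I : Set ℝ} (hI : ¬ Bornology.IsBounded I)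
    (h : ∀ v ∈ I, (Fin.snoc y v : Fin (n + 1) → ℝ) ∈ closure (functionGraph f)) :
    ¬ Bornology.IsBounded (f '' U) := by
  intro hb
  -- `I` lies in the closure of `f '' U`, because the graph meets every open box `U × V` around `(y,
  -- v)`.
  refine hI (hb.closure.subset fun v hv => mem_closure_iff.mpr fun V hV hvV => ?_)
  have hopen : IsOpen {w : Fin (n + 1) → ℝ |
      (fun i : Fin n => w i.castSucc) ∈ U ∧ w (Fin.last n) ∈ V} :=
    (hU.preimage (f := fun (w : Fin (n + 1) → ℝ) (i : Fin n) => w i.castSucc) (by fun_prop)).inter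
      (hV.preimage (continuous_apply (Fin.last n)))
  obtain ⟨_, ⟨h1, h2⟩, x, rfl⟩ := mem_closure_iff.mp (h v hv) _ hopen (by simpa using ⟨hy, hvV⟩)
  simp only [Fin.snoc_castSucc, Fin.snoc_last] at h1 h2
  exact ⟨f x, h2, x, h1, rfl⟩

theorem theorem2 (n m : ℕ) (f : (Fin n → ℝ) → ℝ)
    (hf : SatisfiesFrechet m f) (hpoly : ¬ IsOrdinaryPolynomial f) :
    (∀ U : Set (Fin n → ℝ), IsOpen U → U.Nonempty → ¬ Bornology.IsBounded (f '' U)) ∧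
    ∃ W : Set (Fin (n + 1) → ℝ),
      IsOpen W ∧ ¬ Bornology.IsBounded W ∧ W ⊆ closure (functionGraph f) := by
  obtain ⟨F, hclos, y₀, hy₀⟩ := exists_mvPolynomial_mem_closure_functionGraph hf hpoly
  obtain ⟨a, ha, hval⟩ := MvPolynomial.exists_leadingCoeff_of_eval_cons_ne hy₀
  have hpos : ∀ y, 0 < MvPolynomial.eval y a → ∀ v ∈ Set.Ioi (MvPolynomial.eval (Fin.cons 0 y) F),
      (Fin.snoc y v : Fin (n + 1) → ℝ) ∈ closure (functionGraph f) := by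
    intro y hy v hv
    obtain ⟨t, rfl⟩ := (hval y).1 hy v (le_of_lt hv)
    exact hclos t y
  have hneg : ∀ y, MvPolynomial.eval y a < 0 → ∀ v ∈ Set.Iio (MvPolynomial.eval (Fin.cons 0 y) F),
      (Fin.snoc y v : Fin (n + 1) → ℝ) ∈ closure (functionGraph f) := by
    intro y hy v hv
    obtain ⟨t, rfl⟩ := (hval y).2 hy v (le_of_lt hv)
    exact hclos t y
  have hinit : Continuous fun (w : Fin (n + 1) → ℝ) => (Fin.init w : Fin n → ℝ) := by
    unfold Fin.init; fun_prop
  have hcont : Continuous fun w : Fin (n + 1) → ℝ => MvPolynomial.eval (Fin.init w : Fin n → ℝ) a :=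
    (MvPolynomial.continuous_eval a).comp hinit
  have hcont₀ : Continuous fun w : Fin (n + 1) → ℝ =>
      MvPolynomial.eval (Fin.cons 0 (Fin.init w : Fin n → ℝ)) F :=
    (MvPolynomial.continuous_eval F).comp (continuous_const.finCons hinit)
  refine ⟨fun U hU hne => ?_, ?_⟩
  · obtain ⟨y, hyU, hy⟩ := MvPolynomial.exists_mem_eval_ne_zero ha hU hne
    rcases hy.lt_or_gt with hy | hy
    · exact not_isBounded_image_of_snoc_mem_closure hU hyU (Real.not_isBounded_Iio _) (hneg y hy)
    · exact not_isBounded_image_of_snoc_mem_closure hU hyU (Real.not_isBounded_Ioi _) (hpos y hy)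
  · obtain ⟨y, -, hy⟩ := MvPolynomial.exists_mem_eval_ne_zero ha isOpen_univ Set.univ_nonempty
    rcases hy.lt_or_gt with hy | hy
    -- The region below the graph of `F(0, ·)`, over the open set where the half-lines point down.
    · refine ⟨{w | MvPolynomial.eval (Fin.init w : Fin n → ℝ) a < 0 ∧
          w (Fin.last n) < MvPolynomial.eval (Fin.cons 0 (Fin.init w : Fin n → ℝ)) F}, ?_, ?_, ?_⟩
      · exact (isOpen_lt hcont continuous_const).inter
          (isOpen_lt (continuous_apply (Fin.last n)) hcont₀)
      · exact not_isBounded_of_forall_snoc_mem y (Real.not_isBounded_Iio _) fun v hv => by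
          simpa using ⟨hy, hv⟩
      · rintro w ⟨h1, h2⟩
        simpa using hneg _ h1 _ h2
    · refine ⟨{w | 0 < MvPolynomial.eval (Fin.init w : Fin n → ℝ) a ∧
          MvPolynomial.eval (Fin.cons 0 (Fin.init w : Fin n → ℝ)) F < w (Fin.last n)}, ?_, ?_, ?_⟩
      · exact (isOpen_lt continuous_const hcont).inter
          (isOpen_lt hcont₀ (continuous_apply (Fin.last n)))
      · exact not_isBounded_of_forall_snoc_mem y (Real.not_isBounded_Ioi _) fun v hv => by
          simpa using ⟨hy, hv⟩
      · rintro w ⟨h1, h2⟩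
        simpa using hpos _ h1 _ h2
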